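/- Let $T$ be an infinite, locally finite tree (countable vertex set, also denoted $T$) with a reference vertex $x_0$. For a vertex $x$ let $S(x)$ be the set of neighbours of $x$ other than its parent $x^-$, i.e. those not on the geodesic from $x_0$ to $x$; assume that every $S(x)$ has at least two elements. Let $q(x,y)$ be given for neighbouring $x,y$, with $q(x,y)>0$ for $y\in S(x)$, $q(x,x^-)=0$, and $\sum_{y\in S(x)}q(x,y)=1$. Let $\partial T$ be the set of infinite geodesics $e=(z_0,z_1,\dots)$ with $z_0=x_0$ and $z_{n+1}\in S(z_n)$, with the $\sigma$-algebra generated by the sectors $B_x=\{e: x\in e\}$, and let $\mathbb P$ be the probability measure on it with $\mathbb P(B_x)=\prod_{j<n}q(y_j,y_{j+1})$, where $(y_0,\dots,y_n)$ is the geodesic from $x_0$ to $x$. For a separable Fréchet space $F$ over $\mathbb R$ or $\mathbb C$, whose topology is given by a translation-invariant metric $d$, let $H_Q(T,F)$ be the set of functions $f:T\to F$ with $f(x)=\sum_{y\in S(x)}q(x,y)f(y)$ for all $x$, with the topology of pointwise convergence. Let $L^0(\partial T,F)$ be the space of measurable functions $\partial T\to F$ modulo $\mathbb P$-a.e. equality,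 with the metric $\int_{\partial T}\frac{d(h_1,h_2)}{1+d(h_1,h_2)}\,d\mathbb P$. Put $\omega_n(f)(e)=f(z_n)$ for $e=(z_0,z_1,\dots)$. Let $U_{FM}(T,F)$ be the set of $f\in H_Q(T,F)$ such that for every non-empty open $V\subset L^0(\partial T,F)$ the set $A=\{n\in\mathbb N:\omega_n(f)\in V\}$ has positive lower density, i.e. $\liminf_{n\to\infty}\frac{1}{n+1}\,\#\{m\in A: m\le n\}>0$. Claim 4.2. Let $E$ be a separable Fréchet space over $\mathbb R$ or $\mathbb C$, and let $E^{\mathbb N}$ carry the product topology and any translation-invariant metric inducing it. Then there is $f=(f_1,f_2,\dots)\in U_{FM}(T,E^{\mathbb N})$ whose components $f_1,f_2,\dots$ belong to $H_Q(T,E)$ and form a dense sequence in $H_Q(T,E)$. -/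

import Mathlib

open MeasureTheory Filter Topology
open scoped ENNReal

/-- A locally finite tree with a reference vertex `root`; the vertex set is `V`. -/
structure BasedTree (V : Type*) where
  /-- the underlying graph -/
  graph : SimpleGraph V
  /-- connected and without cycles -/
  isTree : graph.IsTree
  /-- every vertex has finitely many neighbours -/
  finite_neighborSet : ∀ x, (graph.neighborSet x).Finite
  /-- the reference vertex `x₀` -/
  root : V

/-- `T.children x` is the set `S(x)` of the neighbours of `x` other than the parent `x⁻`.
In a tree, the neighbours of `x` are at distance `ℓ(x₀, x) ± 1` from the root `x₀`, and the
parent of `x ≠ x₀` is the only one of them that is closer to the root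
(see `BasedTree.mem_children_iff`). -/
noncomputable def BasedTree.children {V : Type*} (T : BasedTree V) (x : V) : Finset V :=
  (T.finite_neighborSet x).toFinset.filter
    (fun y => T.graph.dist T.root y = T.graph.dist T.root x + 1)

/-- `S(x)` consists of the neighbours of `x` that do not lie on the geodesic from the root
to `x`, given as any path `p` from the root to `x` (it is unique). -/
theorem BasedTree.mem_children_iff {V : Type*} (T : BasedTree V) {x y : V}
    (p : T.graph.Walk T.root x) (hp : p.IsPath) :
    y ∈ T.children x ↔ T.graph.Adj x y ∧ y ∉ p.support := by
  classical
  have hlen : ∀ {z : V} (w : T.graph.Walk T.root z), w.IsPath →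
      w.length = T.graph.dist T.root z := by
    intro z w hw
    obtain ⟨w', hw', hl⟩ := T.isTree.1.exists_path_of_dist T.root z
    rw [(T.isTree.existsUnique_path T.root z).unique hw hw', hl]
  simp only [BasedTree.children, Finset.mem_filter, Set.Finite.mem_toFinset,
    SimpleGraph.mem_neighborSet]
  refine and_congr_right fun hxy => ⟨fun h hy => ?_, fun h => ?_⟩
  · have h1 := hlen (p.takeUntil y hy) (hp.takeUntil hy)
    have h2 := p.length_takeUntil_le_length hy
    have h3 := hlen p hp
    omega
  · have h1 := hlen (p.concat hxy) (hp.concat h hxy)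
    rw [SimpleGraph.Walk.length_concat, hlen p hp] at h1
    exact h1.symm

/-- A rooted tree in which every vertex has at least two children, with transition
probabilities `q(x, y)` along its edges which are positive from a vertex to its children,
zero from a vertex to its parent, and sum to one. Only the values of `q` at pairs of
neighbours are ever used. -/
structure WeightedTree (V : Type*) extends BasedTree V where
  /-- every vertex has at least two children -/
  two_le_card_children : ∀ x, 2 ≤ (toBasedTree.children x).card
  /-- the transition probabilities -/
  q : V → V → ℝ
  q_pos : ∀ x, ∀ y ∈ toBasedTree.children x, 0 < q x y
  q_parent : ∀ x y, graph.Adj x y → y ∉ toBasedTree.children x → q x y = 0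
  q_sum : ∀ x, ∑ y ∈ toBasedTree.children x, q x y = 1

namespace WeightedTree

section Boundary

variable {V : Type*} (T : WeightedTree V)

/-- The boundary `∂T`: the infinite geodesics that start at the root. -/
def Boundary : Type _ :=
  {e : ℕ → V // e 0 = T.root ∧ ∀ n, e (n + 1) ∈ T.children (e n)}

/-- The boundary sector `B_x`: the infinite geodesics through `x`. -/
def sector (x : V) : Set T.Boundary := {e | ∃ n, e.1 n = x}

/-- The `σ`-algebra on `∂T` generated by the boundary sectors. -/
instance : MeasurableSpace T.Boundary :=
  MeasurableSpace.generateFrom (Set.range T.sector)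

/-- The finite set of children of a vertex carries the discrete `σ`-algebra. -/
instance (x : V) : MeasurableSpace (T.children x) := ⊤

instance (x : V) : DiscreteMeasurableSpace (T.children x) := ⟨fun _ => trivial⟩

/-- The probability distribution `q(x, ·)` on the children of `x`. -/
noncomputable def step (x : V) : PMF (T.children x) :=
  PMF.ofFintype (fun y => ENNReal.ofReal (T.q x y)) (by
    rw [Finset.sum_coe_sort (T.children x) (fun y => ENNReal.ofReal (T.q x y)),
      ← ENNReal.ofReal_sum_of_nonneg (fun y hy => (T.q_pos x y hy).le), T.q_sum x,
      ENNReal.ofReal_one])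

/-- The infinite geodesic that starts at the root and follows a given choice of one child
at every vertex. -/
def follow (c : (x : V) → T.children x) : T.Boundary :=
  ⟨fun n => Nat.rec T.root (fun _ v => (c v : V)) n, rfl, fun _ => (c _).2⟩

/-- The probability measure `P` on `∂T`: from every vertex `x` one moves on to a child drawn
from `q(x, ·)`, independently for different vertices. It is the measure that gives the sector
`B_x` of a vertex `x` at distance `n` from the root the mass
`q(y₀, y₁) ⋯ q(yₙ₋₁, yₙ)`, where `y₀, …, yₙ` is the geodesic from the root to `x`
(see `WeightedTree.measure_sector`). -/
noncomputable def measure : Measure T.Boundary :=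
  (Measure.infinitePi (fun x => (T.step x).toMeasure)).map T.follow

theorem dist_apply (e : T.Boundary) (n : ℕ) : T.graph.dist T.root (e.1 n) = n := by
  induction n with
  | zero => rw [e.2.1, SimpleGraph.dist_self]
  | succ n ih =>
    have h := e.2.2 n
    simp only [BasedTree.children, Finset.mem_filter] at h
    rw [h.2, ih]

/-- Two vertices with the same child coincide. -/
theorem eq_of_mem_children {x x' y : V} (h : y ∈ T.children x) (h' : y ∈ T.children x') :
    x = x' := by
  classical
  have key : ∀ {z : V}, y ∈ T.children z → ∀ w : T.graph.Walk T.root y, w.IsPath →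
      w.penultimate = z := by
    intro z hz w hw
    obtain ⟨p, hp, -⟩ := T.isTree.1.exists_path_of_dist T.root z
    obtain ⟨hadj, hns⟩ := (T.mem_children_iff p hp).1 hz
    rw [(T.isTree.existsUnique_path T.root y).unique hw (hp.concat hns hadj),
      SimpleGraph.Walk.penultimate_concat]
  obtain ⟨w, hw, -⟩ := T.isTree.1.exists_path_of_dist T.root y
  rw [← key h w hw, ← key h' w hw]

/-- Two infinite geodesics that meet at level `n` agree up to level `n`. -/
theorem eq_of_apply_eq {e e' : T.Boundary} {n : ℕ} (h : e.1 n = e'.1 n) :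
    ∀ j ≤ n, e.1 j = e'.1 j := by
  induction n with
  | zero => intro j hj; rw [Nat.le_zero.1 hj]; exact h
  | succ n ih =>
    have hn : e.1 n = e'.1 n := T.eq_of_mem_children (e.2.2 n) (h ▸ e'.2.2 n)
    intro j hj
    rcases Nat.le_succ_iff.1 hj with h1 | h1
    · exact ih hn j h1
    · rw [h1]; exact h

theorem mem_sector_apply {e e' : T.Boundary} {n : ℕ} :
    e' ∈ T.sector (e.1 n) ↔ ∀ j ≤ n, e'.1 j = e.1 j := by
  refine ⟨?_, fun h => ⟨n, h n le_rfl⟩⟩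
  rintro ⟨m, hm⟩
  have : m = n := by rw [← T.dist_apply e' m, hm, T.dist_apply]
  subst this
  exact T.eq_of_apply_eq hm

/-- The `n`-th vertex of an infinite geodesic depends measurably on the geodesic. -/
theorem measurableSet_apply_mem [Countable V] (n : ℕ) (A : Set V) :
    MeasurableSet {e : T.Boundary | e.1 n ∈ A} := by
  have hs : ∀ x, MeasurableSet {e : T.Boundary | e.1 n = x} := by
    intro x
    by_cases hx : ∃ e : T.Boundary, e.1 n = x
    · obtain ⟨e, rfl⟩ := hx
      have : {e' : T.Boundary | e'.1 n = e.1 n} = T.sector (e.1 n) := by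
        ext e'
        exact ⟨fun h => ⟨n, h⟩, fun h => (T.mem_sector_apply.1 h) n le_rfl⟩
      rw [this]
      exact MeasurableSpace.measurableSet_generateFrom ⟨_, rfl⟩
    · have : {e' : T.Boundary | e'.1 n = x} = ∅ :=
        Set.eq_empty_iff_forall_notMem.2 fun e he => hx ⟨e, he⟩
      rw [this]
      exact MeasurableSet.empty
  have : {e : T.Boundary | e.1 n ∈ A} = ⋃ x ∈ A, {e : T.Boundary | e.1 n = x} := by
    ext e; simp
  rw [this]
  exact MeasurableSet.biUnion A.to_countable fun x _ => hs x

theorem measurable_follow [Countable V] : Measurable T.follow := by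
  let _ : MeasurableSpace V := ⊤
  have : DiscreteMeasurableSpace V := ⟨fun _ => trivial⟩
  have h : ∀ n, Measurable fun c : (x : V) → T.children x => (T.follow c).1 n := by
    intro n
    induction n with
    | zero => exact measurable_const
    | succ n ih =>
      have h2 : Measurable fun p : ((x : V) → T.children x) × V => ((p.1 p.2 : V)) := by
        refine measurable_from_prod_countable_left fun x => ?_
        exact (measurable_from_top (f := fun y : T.children x => (y : V))).comp
          (measurable_pi_apply x)
      exact h2.comp (measurable_id.prodMk ih)
  refine measurable_generateFrom ?_
  rintro _ ⟨x, rfl⟩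
  have : T.follow ⁻¹' T.sector x = ⋃ n, (fun c => (T.follow c).1 n) ⁻¹' {x} := by
    ext c; simp [sector]
  rw [this]
  exact MeasurableSet.iUnion fun n => h n (measurableSet_singleton x)

instance [Countable V] : IsProbabilityMeasure T.measure :=
  Measure.isProbabilityMeasure_map T.measurable_follow.aemeasurable

theorem measure_sector [Countable V] (e : T.Boundary) (n : ℕ) :
    T.measure (T.sector (e.1 n)) =
      ∏ j ∈ Finset.range n, ENNReal.ofReal (T.q (e.1 j) (e.1 (j + 1))) := by
  classical
  have hinj : Function.Injective e.1 := fun i j h => by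
    rw [← T.dist_apply e i, h, T.dist_apply]
  have hpre : T.follow ⁻¹' T.sector (e.1 n) =
      Set.pi ((Finset.range n).image e.1 : Finset V)
        (fun x => {y : T.children x | ∀ j, e.1 j = x → (y : V) = e.1 (j + 1)}) := by
    ext c
    rw [Set.mem_preimage, T.mem_sector_apply]
    constructor
    · intro h x hx j hj
      obtain ⟨i, hi, rfl⟩ := Finset.mem_image.1 (Finset.mem_coe.1 hx)
      obtain rfl := hinj hj
      have hj := Finset.mem_range.1 hi
      rw [← h (j + 1) hj, ← h j hj.le]
      rfl
    · intro h j hj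
      induction j with
      | zero => rw [e.2.1]; rfl
      | succ j ih =>
        have h1 := ih (Nat.le_of_succ_le hj)
        have h2 := h (e.1 j) (Finset.mem_coe.2 (Finset.mem_image.2
          ⟨j, Finset.mem_range.2 hj, rfl⟩)) j rfl
        rw [← h2, ← h1]
        rfl
  rw [measure, Measure.map_apply T.measurable_follow
    (MeasurableSpace.measurableSet_generateFrom ⟨_, rfl⟩), hpre,
    Measure.infinitePi_pi _ (fun _ _ => MeasurableSet.of_discrete),
    Finset.prod_image (fun i _ j _ h => hinj h)]
  refine Finset.prod_congr rfl fun j _ => ?_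
  have : {y : T.children (e.1 j) | ∀ i, e.1 i = e.1 j → (y : V) = e.1 (i + 1)} =
      {⟨e.1 (j + 1), e.2.2 j⟩} := by
    ext y
    simp only [Set.mem_ofPred_eq, Set.mem_singleton_iff, Subtype.ext_iff]
    exact ⟨fun h => h j rfl, fun h i hi => by rw [hinj hi, h]⟩
  rw [this, PMF.toMeasure_apply_singleton _ _ (MeasurableSet.singleton _), step,
    PMF.ofFintype_apply]

end Boundary

section Harmonic

variable (𝕜 : Type*) [RCLike 𝕜] {V : Type*} (T : WeightedTree V)
  (F : Type*) [AddCommGroup F] [Module 𝕜 F]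

/-- The set `H_Q(T, F)` of the harmonic functions on `T` with values in the `𝕜`-vector space
`F`. As a subset of `V → F` it carries the topology of pointwise convergence. -/
def harmonic : Set (V → F) :=
  {f | ∀ x, f x = ∑ y ∈ T.children x, (T.q x y : 𝕜) • f y}

end Harmonic

section Convergence

variable {V : Type*} (T : WeightedTree V) {F : Type*} [TopologicalSpace F]

/-- The space `L⁰(∂T, F)` of measurable functions `∂T → F` modulo almost everywhere
equality. -/
abbrev L0 (F : Type*) [TopologicalSpace F] : Type _ := T.Boundary →ₘ[T.measure] F

/-- The function `ω_n(f) : ∂T → F` that maps an infinite geodesic to the value of `f` at its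
`n`-th vertex, as an element of `L⁰(∂T, F)`. -/
noncomputable def omega [Countable V] (f : V → F) (n : ℕ) : T.L0 F :=
  AEEqFun.mk (fun e => f (e.1 n)) (by
    let _ : MeasurableSpace V := ⊤
    have : DiscreteMeasurableSpace V := ⟨fun _ => trivial⟩
    let _ : TopologicalSpace V := ⊥
    have : DiscreteTopology V := ⟨rfl⟩
    have h : Measurable fun e : T.Boundary => e.1 n :=
      fun A _ => T.measurableSet_apply_mem n A
    have h2 : StronglyMeasurable fun e : T.Boundary => e.1 n := h.stronglyMeasurable
    exact ((continuous_of_discreteTopology (f := f)).comp_stronglyMeasurable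
      h2).aestronglyMeasurable)

end Convergence

end WeightedTree

/-- `d` is a translation-invariant metric on `F` that induces the given topology of `F`. -/
structure IsInvariantMetric {F : Type*} [AddCommGroup F] [TopologicalSpace F]
    (d : F → F → ℝ) : Prop where
  eq_zero_iff : ∀ x y, d x y = 0 ↔ x = y
  symm : ∀ x y, d x y = d y x
  triangle : ∀ x y z, d x z ≤ d x y + d y z
  translate : ∀ x y z, d (x + z) (y + z) = d x y
  nhds_basis : ∀ x, (𝓝 x).HasBasis (fun r : ℝ => 0 < r) (fun r => {y | d y x < r})

/-- The lower density `liminf (1 / (n + 1)) · card {m ∈ A : m ≤ n}` of a set of natural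
numbers. -/
noncomputable def lowerDensity (A : Set ℕ) : ℝ :=
  liminf (fun n : ℕ => ((A ∩ Set.Iic n).ncard : ℝ) / ((n : ℝ) + 1)) atTop

namespace WeightedTree

section Universal

variable (𝕜 : Type*) [RCLike 𝕜] {V : Type*} (T : WeightedTree V)
  {F : Type*} [AddCommGroup F] [Module 𝕜 F] [TopologicalSpace F]

/-- The distance `∫ d(h₁, h₂) / (1 + d(h₁, h₂)) dP` on `L⁰(∂T, F)`. -/
noncomputable def L0dist (d : F → F → ℝ) (h₁ h₂ : T.L0 F) : ℝ :=
  ∫ e, d (h₁ e) (h₂ e) / (1 + d (h₁ e) (h₂ e)) ∂T.measure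

/-- The open sets of `L⁰(∂T, F)` for the metric `L0dist d`. -/
def IsOpenL0 (d : F → F → ℝ) (A : Set (T.L0 F)) : Prop :=
  ∀ h ∈ A, ∃ ε > 0, ∀ g, T.L0dist d g h < ε → g ∈ A

/-- The set `U_FM(T, F)` of the frequently universal harmonic functions on `T` with values in
the topological vector space `F`, whose topology is given by the metric `d`. -/
def frequentlyUniversal [Countable V] (d : F → F → ℝ) : Set (V → F) :=
  {f | f ∈ T.harmonic 𝕜 F ∧ ∀ A : Set (T.L0 F), T.IsOpenL0 d A → A.Nonempty →
    0 < lowerDensity {n | T.omega f n ∈ A}}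

end Universal

end WeightedTree

/-! Harmonicity at a vertex is one linear equation for the values at its children, so all children
but one can be given any value and the last absorbs the defect. The absorbing child is `small`,
reached with probability at most 1/2. The others receive a target value. Once a geodesic has avoided
a small child, it meets the target, and it keeps doing so while the target is constant along it;
after `k` levels with constant target the failure probability is at most `2⁻¹ ^ k`
(`steer_apply_eq`, `measure_apply_mem_smallRun_le`).

Countably many functions of a single vertex approximate everything in `L⁰`
(`exists_cylinder_approx`). `dyadicIndex` selects each of them on ever longer blocks of levels,
which have positive lower density even without their first few levels.

Coordinate `k` is steered only beyond level `k`; up to there it copies a member of a dense sequence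
of harmonic functions. Closeness in the product involves finitely many coordinates, all steered from
some level on. Pointwise closeness involves finitely many vertices, so density survives if each
member is copied up to arbitrarily high levels. -/

namespace WeightedTree

/-! ### Parents, small children and levels -/

section Vertices

variable {V : Type*} (T : WeightedTree V)

open Classical in
/-- The parent of a vertex; the root is its own parent. -/
noncomputable def parent (y : V) : V :=
  if h : ∃ x, y ∈ T.children x then h.choose else T.root

theorem parent_eq {x y : V} (h : y ∈ T.children x) : T.parent y = x := by
  have hex : ∃ x, y ∈ T.children x := ⟨x, h⟩
  rw [parent, dif_pos hex]
  exact T.eq_of_mem_children hex.choose_spec h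

theorem dist_of_mem_children {x y : V} (h : y ∈ T.children x) :
    T.graph.dist T.root y = T.graph.dist T.root x + 1 := by
  simp only [BasedTree.children, Finset.mem_filter] at h
  exact h.2

theorem parent_iterate (e : T.Boundary) (m k : ℕ) : T.parent^[k] (e.1 (m + k)) = e.1 m := by
  induction k with
  | zero => rfl
  | succ k ih =>
    rw [Function.iterate_succ_apply, ← Nat.add_assoc, T.parent_eq (e.2.2 (m + k)), ih]

theorem exists_small_child (x : V) : ∃ y ∈ T.children x, T.q x y ≤ 1 / 2 := by
  by_contra! h
  have hc := T.two_le_card_children x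
  have hne : (T.children x).Nonempty := Finset.card_pos.1 (by omega)
  have h1 := Finset.sum_lt_sum_of_nonempty hne h
  rw [T.q_sum x, Finset.sum_const, nsmul_eq_mul] at h1
  have h2 : (2 : ℝ) ≤ ((T.children x).card : ℝ) := by exact_mod_cast hc
  linarith

/-- A child which is reached with probability at most `1 / 2`. -/
noncomputable def small (x : V) : V := (T.exists_small_child x).choose

theorem small_mem (x : V) : T.small x ∈ T.children x := (T.exists_small_child x).choose_spec.1

theorem q_small_le (x : V) : T.q x (T.small x) ≤ 1 / 2 :=
  (T.exists_small_child x).choose_spec.2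

/-- A finite set that contains all vertices at level `n`. -/
noncomputable def level [DecidableEq V] : ℕ → Finset V
  | 0 => {T.root}
  | n + 1 => (level n).biUnion fun x => T.children x

theorem apply_mem_level [DecidableEq V] (e : T.Boundary) (n : ℕ) : e.1 n ∈ T.level n := by
  induction n with
  | zero => simp [level, e.2.1]
  | succ n ih => exact Finset.mem_biUnion.2 ⟨_, ih, e.2.2 n⟩

end Vertices

/-! ### Probability of long runs of small children -/

section SmallRuns

variable {V : Type*} (T : WeightedTree V)

/-- The vertices that are reached by `n` successive moves to small children. -/
def smallRun : ℕ → Set V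
  | 0 => Set.univ
  | n + 1 => T.small '' smallRun n

/-- The product formula for the sector of the small child has one more factor, which is at most 1/2.
-/
theorem measure_apply_eq_small_le [Countable V] (n : ℕ) (x : V) :
    T.measure {e | e.1 (n + 1) = T.small x} ≤ 2⁻¹ * T.measure {e | e.1 n = x} := by
  by_cases h : ∃ e : T.Boundary, e.1 (n + 1) = T.small x
  · obtain ⟨e, he⟩ := h
    have hx : e.1 n = x := T.eq_of_mem_children (e.2.2 n) (he ▸ T.small_mem x)
    have hs : ∀ k, {e' : T.Boundary | e'.1 k = e.1 k} = T.sector (e.1 k) := by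
      intro k
      ext e'
      exact ⟨fun h => ⟨k, h⟩, fun h => (T.mem_sector_apply.1 h) k le_rfl⟩
    rw [← he, ← hx, hs, hs, measure_sector, measure_sector, Finset.prod_range_succ, mul_comm,
      he, hx]
    gcongr
    rw [← ENNReal.ofReal_ofNat 2, ← ENNReal.ofReal_inv_of_pos two_pos]
    exact ENNReal.ofReal_le_ofReal ((T.q_small_le x).trans (by norm_num))
  · have : {e : T.Boundary | e.1 (n + 1) = T.small x} = ∅ :=
      Set.eq_empty_iff_forall_notMem.2 fun e he => h ⟨e, he⟩
    simp [this]

theorem measure_apply_mem_image_small_le [Countable V] (n : ℕ) (A : Set V) :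
    T.measure {e | e.1 (n + 1) ∈ T.small '' A} ≤ 2⁻¹ * T.measure {e | e.1 n ∈ A} := by
  have h1 : {e : T.Boundary | e.1 (n + 1) ∈ T.small '' A} =
      ⋃ x : A, {e | e.1 (n + 1) = T.small x} := by
    ext e; simp [eq_comm]
  have h2 : {e : T.Boundary | e.1 n ∈ A} = ⋃ x : A, {e : T.Boundary | e.1 n = (x : V)} := by
    ext e; simp
  have hm : ∀ x : V, MeasurableSet {e : T.Boundary | e.1 n = x} :=
    fun x => T.measurableSet_apply_mem n {x}
  rw [h1, h2, measure_iUnion _ fun x : A => hm x, ← ENNReal.tsum_mul_left]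
  · exact (measure_iUnion_le _).trans
      (ENNReal.tsum_le_tsum fun x => T.measure_apply_eq_small_le n x)
  · intro x y hxy
    refine Set.disjoint_left.2 fun e (he : e.1 n = x) (he' : e.1 n = y) => hxy ?_
    exact Subtype.ext (he.symm.trans he')

theorem measure_apply_mem_smallRun_le [Countable V] (n k : ℕ) :
    T.measure {e | e.1 (n + k) ∈ T.smallRun k} ≤ 2⁻¹ ^ k := by
  induction k with
  | zero => simp [smallRun]
  | succ k ih =>
    rw [pow_succ']
    exact (T.measure_apply_mem_image_small_le (n + k) _).trans (by gcongr)

end SmallRuns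

/-! ### Harmonic functions steered towards a target -/

section Steering

variable (𝕜 : Type*) [RCLike 𝕜] {V : Type*} (T : WeightedTree V)
  {E : Type*} [AddCommGroup E] [Module 𝕜 E]

open Classical in
/-- Auxiliary function for `steer`, by recursion on the level. -/
noncomputable def steerAux (N : ℕ) (g w : V → E) : ℕ → V → E
  | 0, y => g y
  | n + 1, y => if n + 1 ≤ N then g y else
      w (T.parent y) + if y = T.small (T.parent y) then
        (T.q (T.parent y) y : 𝕜)⁻¹ • (steerAux N g w n (T.parent y) - w (T.parent y)) else 0

/-- The function that equals `g` up to level `N` and, from then on, takes the value `w x` at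
the children of a vertex `x`, except at the small child, whose value makes it harmonic. -/
noncomputable def steer (N : ℕ) (g w : V → E) (x : V) : E :=
  T.steerAux 𝕜 N g w (T.graph.dist T.root x) x

theorem steer_of_le {N : ℕ} (g w : V → E) {x : V} (h : T.graph.dist T.root x ≤ N) :
    T.steer 𝕜 N g w x = g x := by
  rw [steer]
  cases hd : T.graph.dist T.root x with
  | zero => rfl
  | succ n => rw [steerAux, if_pos (by omega)]

open Classical in
theorem steer_of_mem_children {N : ℕ} (g w : V → E) {x y : V} (hy : y ∈ T.children x)
    (h : N ≤ T.graph.dist T.root x) :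
    T.steer 𝕜 N g w y = w x +
      if y = T.small x then (T.q x y : 𝕜)⁻¹ • (T.steer 𝕜 N g w x - w x) else 0 := by
  rw [steer, T.dist_of_mem_children hy, steerAux, if_neg (by omega), T.parent_eq hy]
  rfl

/-- From level `N` on, the weights sum to one, so the target contributes `w x`; at the small child
`q` cancels `q⁻¹`, which restores the missing difference. -/
theorem steer_mem_harmonic (N : ℕ) {g : V → E} (hg : g ∈ T.harmonic 𝕜 E) (w : V → E) :
    T.steer 𝕜 N g w ∈ T.harmonic 𝕜 E := by
  classical
  intro x
  rcases lt_or_ge (T.graph.dist T.root x) N with h | h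
  · rw [T.steer_of_le 𝕜 g w h.le, hg x]
    refine Finset.sum_congr rfl fun y hy => ?_
    rw [T.steer_of_le 𝕜 g w]
    rw [T.dist_of_mem_children hy]
    exact h
  · have hq : (T.q x (T.small x) : 𝕜) ≠ 0 := by
      exact_mod_cast (T.q_pos x _ (T.small_mem x)).ne'
    have hsum : ∑ y ∈ T.children x, (T.q x y : 𝕜) = 1 := by exact_mod_cast T.q_sum x
    rw [Finset.sum_congr rfl fun y hy => by rw [T.steer_of_mem_children 𝕜 g w hy h, smul_add]]
    simp only [Finset.sum_add_distrib, ← Finset.sum_smul, hsum, one_smul, smul_ite, smul_zero,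
      Finset.sum_ite_eq', T.small_mem x, if_true]
    rw [smul_smul, mul_inv_cancel₀ hq, one_smul]
    abel

/-- Along a geodesic, the values of `steer` agree with a constant target unless the geodesic
has only moved to small children. -/
theorem steer_apply_eq {N : ℕ} (g w : V → E) (e : T.Boundary) {n k : ℕ} {v : E} (hN : N ≤ n)
    (hw : ∀ i < k, w (e.1 (n + i)) = v) (he : e.1 (n + k) ∉ T.smallRun k) :
    T.steer 𝕜 N g w (e.1 (n + k)) = v := by
  classical
  induction k with
  | zero => exact absurd (Set.mem_univ _) he
  | succ k ih =>
    rw [← Nat.add_assoc, T.steer_of_mem_children 𝕜 g w (e.2.2 (n + k))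
      (by rw [T.dist_apply]; omega), hw k k.lt_succ_self]
    -- A step to a small child passes on the defect, which is zero by induction; any other step
    -- meets the target at once.
    split_ifs with hs
    · rw [ih (fun i hi => hw i (hi.trans k.lt_succ_self)), sub_self, smul_zero, add_zero]
      exact fun hk => he ⟨_, hk, hs.symm⟩
    · exact add_zero v

end Steering

end WeightedTree

/-! ### Lower density and dyadic blocks -/

theorem lowerDensity_pos {A : Set ℕ} (i L : ℕ)
    (h : ∀ p n, 2 ^ (p + i + 1) + 2 ^ p + L ≤ n → n < 2 ^ (p + i + 1) + 2 ^ (p + 1) → n ∈ A) :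
    0 < lowerDensity A := by
  have hfin : ∀ n, (A ∩ Set.Iic n).Finite := fun n => (Set.finite_Iic n).inter_of_right A
  -- With `p` below, the block of length `2 ^ p` ends by `n`, at least half of it remains after
  -- dropping `L` points, and `n + 1 < 2 ^ (p + i + 3)`.
  refine lt_of_lt_of_le (b := ((2 : ℝ) ^ (i + 4))⁻¹) (by positivity) ?_
  refine le_liminf_of_le ?_ ?_
  · refine isCoboundedUnder_ge_of_le atTop (x := 1) fun n => ?_
    rw [div_le_one (by positivity)]
    have h1 := Set.ncard_le_ncard (Set.inter_subset_right (s := A) (t := Set.Iic n))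
      (Set.finite_Iic n)
    rw [Set.ncard_eq_toFinset_card' (Set.Iic n), Set.toFinset_Iic, Nat.card_Iic] at h1
    exact_mod_cast h1
  · filter_upwards [eventually_ge_atTop (2 ^ (L + 1 + (i + 2)))] with n hn
    obtain ⟨p, hp⟩ : ∃ p, Nat.log 2 (n + 1) = p + (i + 2) :=
      ⟨_, (Nat.sub_add_cancel ((by omega : i + 2 ≤ L + 1 + (i + 2)).trans
        (Nat.le_log_of_pow_le one_lt_two (by omega)))).symm⟩
    have hLp : L + 1 ≤ p := by
      have := Nat.le_log_of_pow_le one_lt_two (hn.trans n.le_succ)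
      rw [Nat.succ_eq_add_one, hp] at this
      omega
    have h1 : 2 ^ (p + (i + 2)) ≤ n + 1 := hp ▸ Nat.pow_log_le_self 2 n.succ_ne_zero
    have h2 : n + 1 < 2 ^ (p + (i + 2) + 1) := hp ▸ Nat.lt_pow_succ_log_self one_lt_two _
    have h3 : 2 * L ≤ 2 ^ p := by
      calc 2 * L ≤ 2 * 2 ^ L := by gcongr; exact Nat.lt_two_pow_self.le
        _ = 2 ^ (L + 1) := by ring
        _ ≤ 2 ^ p := Nat.pow_le_pow_right two_pos hLp
    have h4 : 2 ^ (p + 1) ≤ 2 ^ (p + i + 1) := Nat.pow_le_pow_right two_pos (by omega)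
    have h5 : 2 ^ (p + (i + 2)) = 2 * 2 ^ (p + i + 1) := by ring
    have hsub : Set.Ico (2 ^ (p + i + 1) + 2 ^ p + L) (2 ^ (p + i + 1) + 2 ^ (p + 1)) ⊆
        A ∩ Set.Iic n := by
      rintro m ⟨hm1, hm2⟩
      exact ⟨h p m hm1 hm2, by rw [Set.mem_Iic]; omega⟩
    have h6 := Set.ncard_le_ncard hsub (hfin n)
    rw [Set.ncard_eq_toFinset_card' (Set.Ico _ _), Set.toFinset_Ico, Nat.card_Ico] at h6
    have h7 : 2 ^ p ≤ 2 * (A ∩ Set.Iic n).ncard := by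
      have : 2 ^ (p + 1) = 2 * 2 ^ p := by ring
      omega
    have h8 : n + 1 ≤ (A ∩ Set.Iic n).ncard * 2 ^ (i + 4) := by
      have : 2 ^ (p + (i + 2) + 1) = 2 ^ p * 2 ^ (i + 3) := by ring
      calc n + 1 ≤ 2 ^ p * 2 ^ (i + 3) := by omega
        _ ≤ (2 * (A ∩ Set.Iic n).ncard) * 2 ^ (i + 3) := by gcongr
        _ = _ := by ring
    rw [le_div_iff₀ (by positivity), inv_mul_le_iff₀ (by positivity), mul_comm]
    exact_mod_cast h8

/-- A sequence that is constant on longer and longer intervals and takes each value with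
positive lower density. -/
def dyadicIndex (n : ℕ) : ℕ := Nat.log 2 n - Nat.log 2 (n - 2 ^ Nat.log 2 n) - 1

/-- The two highest binary ones of `n` are at positions `p + i + 1` and `p`. -/
theorem dyadicIndex_eq {p i n : ℕ} (h : 2 ^ (p + i + 1) + 2 ^ p ≤ n)
    (h' : n < 2 ^ (p + i + 1) + 2 ^ (p + 1)) : dyadicIndex n = i := by
  have h4 : 2 ^ (p + 1) ≤ 2 ^ (p + i + 1) := Nat.pow_le_pow_right two_pos (by omega)
  have h5 : 2 ^ (p + i + 1 + 1) = 2 * 2 ^ (p + i + 1) := by ring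
  have h1 : Nat.log 2 n = p + i + 1 := Nat.log_eq_of_pow_le_of_lt_pow (by omega) (by omega)
  have h2 : Nat.log 2 (n - 2 ^ (p + i + 1)) = p :=
    Nat.log_eq_of_pow_le_of_lt_pow (by omega) (by omega)
  rw [dyadicIndex, h1, h2]
  omega

/-- The ends of the constant runs of `dyadicIndex` of a given length, value and minimal starting
point have positive lower density. -/
theorem lowerDensity_pos_of_dyadicIndex {A : Set ℕ} (i k s : ℕ)
    (h : ∀ n, s ≤ n → (∀ l < k, dyadicIndex (n + l) = i) → n + k ∈ A) : 0 < lowerDensity A := by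
  -- Dropping `k + s` points leaves a run of length `k`, starting no earlier than `s`, before each
  -- remaining point.
  refine lowerDensity_pos i (k + s) fun p n hn hn' => ?_
  have h1 := Nat.two_pow_pos (p + i)
  have h2 := Nat.two_pow_pos p
  obtain ⟨m, rfl⟩ : ∃ m, n = m + k := ⟨n - k, by omega⟩
  exact h m (by omega) fun l hl => dyadicIndex_eq (p := p) (by omega) (by omega)

/-! ### Invariant metrics -/

namespace IsInvariantMetric

variable {F : Type*} [AddCommGroup F] [TopologicalSpace F] {d : F → F → ℝ}

theorem self_eq_zero (hd : IsInvariantMetric d) (x : F) : d x x = 0 := (hd.eq_zero_iff x x).2 rfl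

theorem nonneg (hd : IsInvariantMetric d) (x y : F) : 0 ≤ d x y := by
  have h := hd.triangle x y x
  rw [hd.self_eq_zero, hd.symm y x] at h
  linarith

theorem eq_sub (hd : IsInvariantMetric d) (x y : F) : d x y = d (x - y) 0 := by
  have h := hd.translate (x - y) 0 y
  rwa [sub_add_cancel, zero_add] at h

theorem isOpen_ball (hd : IsInvariantMetric d) (x : F) (r : ℝ) : IsOpen {y | d y x < r} := by
  refine isOpen_iff_mem_nhds.2 fun y (hy : d y x < r) => ?_
  refine (hd.nhds_basis y).mem_iff.2 ⟨r - d y x, sub_pos.2 hy, fun z (hz : d z y < _) => ?_⟩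
  have := hd.triangle z y x
  show d z x < r
  linarith

/-- Sequences that agree in sufficiently many coordinates are close to each other. -/
theorem exists_agree_imp_lt {E : Type*} [AddCommGroup E] [TopologicalSpace E]
    {d : (ℕ → E) → (ℕ → E) → ℝ} (hd : IsInvariantMetric d) {r : ℝ} (hr : 0 < r) :
    ∃ K : ℕ, ∀ a b : ℕ → E, (∀ k < K, a k = b k) → d a b < r := by
  have h0 : {y | d y 0 < r} ∈ 𝓝 (0 : ℕ → E) := (hd.nhds_basis 0).mem_of_mem hr
  rw [nhds_pi, Filter.mem_pi'] at h0
  obtain ⟨I, t, ht, hsub⟩ := h0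
  refine ⟨I.sup id + 1, fun a b hab => ?_⟩
  rw [hd.eq_sub]
  refine hsub fun i hi => ?_
  rw [Pi.sub_apply, hab i (Nat.lt_succ_of_le (Finset.le_sup (f := id) hi)), sub_self]
  exact mem_of_mem_nhds (ht i)

end IsInvariantMetric

namespace WeightedTree

/-! ### Approximation in measure by cylinder functions -/

section Cylinders

variable {V : Type*} (T : WeightedTree V)

/-- The sets of geodesics that are determined by one vertex of the geodesic. -/
def cylinders : Set (Set T.Boundary) := {C | ∃ (m : ℕ) (B : Set V), C = {e | e.1 m ∈ B}}

/-- Iterated parents recover the earlier vertex from the later one, so finitely many cylinders can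
be read off at a common level. -/
theorem exists_apply_mem_iff_of_le {m n : ℕ} (h : m ≤ n) (B : Set V) :
    ∃ B' : Set V, ∀ e : T.Boundary, e.1 n ∈ B' ↔ e.1 m ∈ B := by
  obtain ⟨k, rfl⟩ := Nat.exists_eq_add_of_le h
  exact ⟨T.parent^[k] ⁻¹' B, fun e => by rw [Set.mem_preimage, T.parent_iterate]⟩

theorem isSetAlgebra_cylinders : IsSetAlgebra T.cylinders where
  empty_mem := ⟨0, ∅, by simp⟩
  compl_mem := by
    rintro _ ⟨m, B, rfl⟩
    exact ⟨m, Bᶜ, rfl⟩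
  union_mem := by
    rintro _ _ ⟨m, B, rfl⟩ ⟨n, C, rfl⟩
    obtain ⟨B', hB⟩ := T.exists_apply_mem_iff_of_le (le_max_left m n) B
    obtain ⟨C', hC⟩ := T.exists_apply_mem_iff_of_le (le_max_right m n) C
    refine ⟨max m n, B' ∪ C', ?_⟩
    ext e
    exact or_congr (hB e).symm (hC e).symm

theorem measureDense_cylinders [Countable V] : T.measure.MeasureDense T.cylinders := by
  refine Measure.MeasureDense.of_generateFrom_isSetAlgebra_finite _ T.isSetAlgebra_cylinders
    (le_antisymm ?_ ?_)
  · refine MeasurableSpace.generateFrom_mono ?_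
    rintro _ ⟨x, rfl⟩
    refine ⟨T.graph.dist T.root x, {x}, ?_⟩
    ext e
    refine ⟨?_, fun h => ⟨_, h⟩⟩
    rintro ⟨n, rfl⟩
    show e.1 _ = _
    rw [T.dist_apply]
  · refine MeasurableSpace.generateFrom_le ?_
    rintro _ ⟨m, B, rfl⟩
    exact T.measurableSet_apply_mem m B

/-- Measurable functions are approximated in measure by functions with finitely many values in
a dense sequence that depend on one vertex of the geodesic only. -/
theorem exists_cylinder_approx [Countable V] {F : Type*} [AddCommGroup F] [TopologicalSpace F]
    [TopologicalSpace.PseudoMetrizableSpace F] {d : F → F → ℝ} (hd : IsInvariantMetric d)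
    {u : ℕ → F} (hu : DenseRange u) {h : T.Boundary → F} (hh : StronglyMeasurable h)
    {δ : ℝ} (hδ : 0 < δ) {η : ℝ} (hη : 0 < η) :
    ∃ (m : ℕ) (κ : V →₀ ℕ), ∃ G : Set T.Boundary, T.measure.real G < η ∧
      ∀ e ∉ G, d (u (κ (e.1 m))) (h e) < δ := by
  classical
  let _ : MeasurableSpace F := borel F
  have : BorelSpace F := ⟨rfl⟩
  set D : ℕ → Set T.Boundary := fun k => h ⁻¹' {y | d y (u k) < δ} with hD
  have hDm : ∀ k, MeasurableSet (D k) :=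
    fun k => hh.measurable (hd.isOpen_ball (u k) δ).measurableSet
  have hDu : ⋃ k, D k = Set.univ := by
    refine Set.eq_univ_of_forall fun e => ?_
    obtain ⟨_, hy, k, rfl⟩ := hu.inter_open_nonempty _ (hd.isOpen_ball (h e) δ)
      ⟨h e, by simpa [hd.self_eq_zero] using hδ⟩
    exact Set.mem_iUnion.2 ⟨k, by simpa [hD, hd.symm (h e)] using hy⟩
  obtain ⟨K, hK⟩ : ∃ K, T.measure.real (Set.accumulate D K)ᶜ < η / 2 := by
    have h1 := tendsto_measure_iUnion_accumulate (μ := T.measure) (f := D)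
    rw [hDu, measure_univ] at h1
    obtain ⟨K, hK⟩ := (((ENNReal.tendsto_toReal ENNReal.one_ne_top).comp h1).eventually_const_lt
      (u := 1 - η / 2) (by rw [ENNReal.toReal_one]; linarith)).exists
    have hm : MeasurableSet (Set.accumulate D K) :=
      MeasurableSet.biUnion (Set.to_countable _) fun k _ => hDm k
    refine ⟨K, ?_⟩
    rw [probReal_compl_eq_one_sub hm, sub_lt_comm]
    exact hK
  have hε : 0 < η / (2 * (K + 1)) := by positivity
  have happ : ∀ k, ∃ (m : ℕ) (B : Set V),
      T.measure.real (symmDiff (D k) {e | e.1 m ∈ B}) < η / (2 * (K + 1)) := by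
    intro k
    obtain ⟨_, ⟨m, B, rfl⟩, hB⟩ :=
      T.measureDense_cylinders.approx (D k) (hDm k) (measure_ne_top _ _) _ hε
    refine ⟨m, B, ?_⟩
    rw [Measure.real]
    exact (ENNReal.toReal_lt_of_lt_ofReal hB)
  choose m B hB using happ
  set M := (Finset.range (K + 1)).sup m
  have hex : ∀ k, ∃ B' : Set V, k ≤ K → ∀ e : T.Boundary, e.1 M ∈ B' ↔ e.1 (m k) ∈ B k := by
    intro k
    by_cases hk : k ≤ K
    · obtain ⟨B', hB'⟩ := T.exists_apply_mem_iff_of_le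
        (Finset.le_sup (f := m) (Finset.mem_range.2 (Nat.lt_succ_of_le hk))) (B k)
      exact ⟨B', fun _ => hB'⟩
    · exact ⟨∅, fun h => absurd h hk⟩
  choose C hC using hex
  -- The vertex is sent to the least index whose cylinder contains it. Cutting off outside the
  -- finite level makes `κ` finitely supported, so that only countably many `κ` occur.
  refine ⟨M, Finsupp.onFinset (T.level M)
    (fun x => if x ∈ T.level M then sInf {k | k ≤ K ∧ x ∈ C k} else 0)
    (fun x hx => by by_contra h; simp [h] at hx),
    (Set.accumulate D K)ᶜ ∪ ⋃ k ∈ Finset.range (K + 1), symmDiff (D k) {e | e.1 (m k) ∈ B k},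
    ?_, fun e he => ?_⟩
  · have h1 : T.measure.real (⋃ k ∈ Finset.range (K + 1), symmDiff (D k) {e | e.1 (m k) ∈ B k})
        ≤ η / 2 := by
      refine (measureReal_biUnion_finset_le _ _).trans
        ((Finset.sum_le_sum fun k _ => (hB k).le).trans ?_)
      rw [Finset.sum_const, Finset.card_range, nsmul_eq_mul]
      push_cast
      exact le_of_eq (by field_simp)
    refine (measureReal_union_le _ _).trans_lt ?_
    linarith
  · rw [Finsupp.onFinset_apply, if_pos (T.apply_mem_level e M)]
    rw [Set.mem_union, not_or, Set.notMem_compl_iff, Set.mem_accumulate] at he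
    obtain ⟨⟨k, hk, hek⟩, he⟩ := he
    have hiff : ∀ l ≤ K, (e ∈ D l ↔ e.1 (m l) ∈ B l) := by
      intro l hl
      by_contra hne
      refine he (Set.mem_biUnion (Finset.mem_range.2 (Nat.lt_succ_of_le hl)) ?_)
      rw [Set.mem_symmDiff, Set.mem_ofPred_eq]
      tauto
    have hne : {k | k ≤ K ∧ e.1 M ∈ C k}.Nonempty := by
      refine ⟨k, hk, (hC k hk e).2 ?_⟩
      exact (hiff k hk).1 hek
    obtain ⟨h1, h2⟩ := Nat.sInf_mem hne
    rw [hd.symm]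
    exact (hiff _ h1).2 ((hC _ h1 e).1 h2)

/-- The distance of `L⁰` is small for functions that are close off a small set. -/
theorem L0dist_le [Countable V] {F : Type*} [AddCommGroup F] [TopologicalSpace F]
    {d : F → F → ℝ} (hd : IsInvariantMetric d) {h₁ h₂ : T.L0 F} {g : T.Boundary → F}
    (hg : h₁ =ᵐ[T.measure] g) {δ : ℝ} (hδ : 0 ≤ δ) {G : Set T.Boundary}
    (h : ∀ e ∉ G, d (g e) (h₂ e) ≤ δ) :
    T.L0dist d h₁ h₂ ≤ δ + T.measure.real G := by
  -- `G` need not be measurable; its measurable hull has the same mass.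
  set G' := toMeasurable T.measure G with hG'
  have hm : MeasurableSet G' := measurableSet_toMeasurable _ _
  have hi : Integrable (G'.indicator fun _ => (1 : ℝ)) T.measure :=
    (integrable_const 1).indicator hm
  calc T.L0dist d h₁ h₂ ≤ ∫ e, (δ + G'.indicator (fun _ => (1 : ℝ)) e) ∂T.measure := by
        refine integral_mono_of_nonneg (Eventually.of_forall fun e => ?_)
          ((integrable_const δ).add hi) ?_
        · exact div_nonneg (hd.nonneg _ _) (add_nonneg zero_le_one (hd.nonneg _ _))
        · filter_upwards [hg] with e he
          have h0 := hd.nonneg (h₁ e) (h₂ e)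
          by_cases heG : e ∈ G'
          · rw [Set.indicator_of_mem heG, div_le_iff₀ (by linarith)]
            nlinarith
          · rw [Set.indicator_of_notMem heG, add_zero, div_le_iff₀ (by linarith)]
            have := h e fun h => heG (subset_toMeasurable _ _ h)
            rw [← he] at this
            nlinarith
    _ = δ + T.measure.real G := by
        rw [integral_add (integrable_const δ) hi, integral_const, integral_indicator_const _ hm]
        simp [hG', Measure.real, measure_toMeasurable]

end Cylinders

end WeightedTree

namespace WeightedTree

/-! ### The universal function and density of its coordinates -/

section Construction

variable {V : Type*} (T : WeightedTree V)

/-- The target values at a vertex `x`: the sequence `dyadicIndex` selects at every level one of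
the cylinder functions enumerated by `s`, which is evaluated at `x`. -/
noncomputable def target {F : Type*} (u : ℕ → F) (s : ℕ → ℕ × (V →₀ ℕ)) (x : V) : F :=
  u ((s (dyadicIndex (T.graph.dist T.root x))).2
    (T.parent^[T.graph.dist T.root x - (s (dyadicIndex (T.graph.dist T.root x))).1] x))

/-- From level `(s i).1` on, the subtraction in `target` is not truncated, so the target depends
only on the vertex at that level and is constant during a run. -/
theorem target_apply {F : Type*} (u : ℕ → F) (s : ℕ → ℕ × (V →₀ ℕ)) (e : T.Boundary) {n i : ℕ}
    (hi : dyadicIndex n = i) (hn : (s i).1 ≤ n) :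
    T.target u s (e.1 n) = u ((s i).2 (e.1 (s i).1)) := by
  obtain ⟨k, rfl⟩ := Nat.exists_eq_add_of_le hn
  rw [target, T.dist_apply, hi, Nat.add_sub_cancel_left, T.parent_iterate]

/-- A function steered towards the target values, where the `k`-th coordinate is prescribed
up to level `k`, is frequently universal. -/
theorem steer_mem_frequentlyUniversal {𝕜 : Type*} [RCLike 𝕜] [Countable V] {E : Type*}
    [AddCommGroup E] [Module 𝕜 E] [TopologicalSpace E]
    [TopologicalSpace.PseudoMetrizableSpace (ℕ → E)] {d : (ℕ → E) → (ℕ → E) → ℝ}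
    (hd : IsInvariantMetric d) {g : ℕ → V → E} (hg : ∀ k, g k ∈ T.harmonic 𝕜 E)
    {u : ℕ → ℕ → E} (hu : DenseRange u) {s : ℕ → ℕ × (V →₀ ℕ)} (hs : Function.Surjective s) :
    (fun x k => T.steer 𝕜 k (g k) (fun y => T.target u s y k) x) ∈
      T.frequentlyUniversal 𝕜 d := by
  refine ⟨fun x => ?_, fun A hA ⟨h, hh⟩ => ?_⟩
  · ext k
    rw [Finset.sum_apply]
    exact T.steer_mem_harmonic 𝕜 k (hg k) _ x
  obtain ⟨ε, hε, hball⟩ := hA h hh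
  obtain ⟨m, κ, G, hG, hκ⟩ := T.exists_cylinder_approx hd hu h.stronglyMeasurable
    (show 0 < ε / 4 by positivity) (show 0 < ε / 4 by positivity)
  obtain ⟨K, hK⟩ := hd.exists_agree_imp_lt (show 0 < ε / 4 by positivity)
  obtain ⟨i, hi⟩ := hs (m, κ)
  obtain ⟨L, hpow⟩ := exists_pow_lt_of_lt_one (show 0 < ε / 4 by positivity)
    (show (2⁻¹ : ℝ) < 1 by norm_num)
  -- Beyond level `m` the target is the chosen cylinder function; beyond level `K` all coordinates
  -- below `K` are steered. Four errors of `ε / 4` arise: metric, cylinder, `G` and small runs.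
  refine lowerDensity_pos_of_dyadicIndex i L (max m K) fun n hn hrun => hball _ ?_
  have hS : T.measure.real {e | e.1 (n + L) ∈ T.smallRun L} ≤ 2⁻¹ ^ L := by
    refine (ENNReal.toReal_mono (by simp) (T.measure_apply_mem_smallRun_le n L)).trans
      (le_of_eq ?_)
    simp
  refine (T.L0dist_le hd (AEEqFun.coeFn_mk _ _) (show 0 ≤ ε / 2 by positivity)
    (G := G ∪ {e | e.1 (n + L) ∈ T.smallRun L}) fun e he => ?_).trans_lt ?_
  · rw [Set.mem_union, not_or] at he
    have h1 : d (fun k => T.steer 𝕜 k (g k) (fun y => T.target u s y k) (e.1 (n + L)))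
        (u (κ (e.1 m))) < ε / 4 := by
      refine hK _ _ fun k hk => T.steer_apply_eq 𝕜 (g k) _ e
        (hk.le.trans ((le_max_right m K).trans hn)) (fun l hl => ?_) he.2
      have hm : (s i).1 ≤ n + l := by
        rw [hi]
        exact (le_max_left m K).trans (hn.trans (Nat.le_add_right n l))
      rw [T.target_apply u s e (hrun l hl) hm, hi]
    have h2 := hd.triangle (fun k => T.steer 𝕜 k (g k) (fun y => T.target u s y k) (e.1 (n + L)))
        (u (κ (e.1 m))) (h e)
    have h3 := hκ e he.1
    linarith
  · have := measureReal_union_le (μ := T.measure) G {e | e.1 (n + L) ∈ T.smallRun L}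
    linarith

/-- If every member of a dense sequence is perturbed outside of a ball around the root, where
radii that are arbitrarily large are used for every member, then the sequence remains dense. -/
theorem denseRange_of_eq_on_balls {X : Type*} [TopologicalSpace X] {H : Set (V → X)}
    {g : ℕ → H} (hg : DenseRange g) {f : ℕ → H}
    (hf : ∀ k x, T.graph.dist T.root x ≤ k → (f k).1 x = (g k.unpair.1).1 x) :
    DenseRange f := by
  refine dense_iff_inter_open.2 fun U hU hne => ?_
  obtain ⟨_, hgU, a, rfl⟩ := hg.inter_open_nonempty U hU hne
  obtain ⟨W, hW, rfl⟩ := isOpen_induced_iff.1 hU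
  have hn := hW.mem_nhds hgU
  rw [nhds_pi, Filter.mem_pi'] at hn
  obtain ⟨I, t, ht, hsub⟩ := hn
  -- The second entry of the pair makes the index at least the radius of `I`, while the first still
  -- selects `a`.
  refine ⟨_, hsub fun x hx => ?_, Nat.pair a (I.sup fun x => T.graph.dist T.root x), rfl⟩
  rw [hf _ x ((Finset.le_sup (f := fun x => T.graph.dist T.root x) hx).trans
    (Nat.right_le_pair _ _)), Nat.unpair_pair]
  exact mem_of_mem_nhds (ht x)

end Construction

end WeightedTree

theorem claim4p2 {𝕜 : Type*} [RCLike 𝕜] {V : Type*} [Countable V] (T : WeightedTree V)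
    {E : Type*} [AddCommGroup E] [Module 𝕜 E] [UniformSpace E] [IsUniformAddGroup E]
    [ContinuousSMul 𝕜 E] [PolynormableSpace 𝕜 E] [CompleteSpace E]
    [TopologicalSpace.MetrizableSpace E] [TopologicalSpace.SeparableSpace E]
    (d : (ℕ → E) → (ℕ → E) → ℝ) (hd : IsInvariantMetric d) :
    ∃ f ∈ T.frequentlyUniversal 𝕜 d,
      ∃ hf : ∀ k : ℕ, (fun x => f x k) ∈ T.harmonic 𝕜 E,
        DenseRange (fun k : ℕ => (⟨fun x => f x k, hf k⟩ : T.harmonic 𝕜 E)) := by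
  have : (uniformity E).IsCountablyGenerated :=
    -- Second countability, unlike separability, passes to the subspace of harmonic functions.
    IsUniformAddGroup.uniformity_countably_generated
  have : SecondCountableTopology E := UniformSpace.secondCountable_of_separable E
  have : TopologicalSpace.PseudoMetrizableSpace (ℕ → E) := UniformSpace.pseudoMetrizableSpace
  have : Nonempty (T.harmonic 𝕜 E) := ⟨⟨0, fun x => by simp⟩⟩
  obtain ⟨g, hg⟩ := TopologicalSpace.exists_dense_seq (T.harmonic 𝕜 E)
  obtain ⟨u, hu⟩ := TopologicalSpace.exists_dense_seq (ℕ → E)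
  obtain ⟨s, hs⟩ := exists_surjective_nat (ℕ × (V →₀ ℕ))
  refine ⟨_, T.steer_mem_frequentlyUniversal hd (fun k => (g k.unpair.1).2) hu hs,
    fun k => T.steer_mem_harmonic 𝕜 k (g k.unpair.1).2 _, ?_⟩
  exact T.denseRange_of_eq_on_balls hg fun k x hx => T.steer_of_le 𝕜 _ _ hx
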